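/- Let $\mathbf A = 17_{37}$ be the relation algebra with the four atoms $\mathrm{id}, a, r, \breve r$ ($a$ symmetric, $r$ asymmetric with converse $\breve r$) in which a triple $(x,y,z)$ of atoms other than $\mathrm{id}$ is allowed, i.e. $z \le x \circ y$, unless it lies in the cycle of $(r,r,a)$, that is, in $\{(r,r,a),(\breve r,a,r),(a,\breve r,r),(a,r,\breve r),(r,a,\breve r),(\breve r,\breve r,a)\}$. An $\mathbf A$-network is a pair $(V,f)$ with $V$ a finite set and $f\colon V^2 \to \mathbf A$. It is atomic if every $f(x,y)$ is an atom, and consistent if $f(x,y) \le f(x,z)\circ f(z,y)$ and $f(x,x)\le \mathrm{id}$ for all $x,y,z\in V$. A representation $\mathfrak B$ of $\mathbf A$ with domain $B$ interprets the elements of $\mathbf A$ by binary relations on $B$ such that $0^{\mathfrak B}=\varnothing$, $1^{\mathfrak B}=\bigcup_{c\in\mathbf A} c^{\mathfrak B}$, $\mathrm{id}^{\mathfrak B}$ is equality, $(\bar c)^{\mathfrak B}=1^{\mathfrak B}\setminus c^{\mathfrak B}$, and union, converse and composition are interpreted by union, converse and composition of relations; it is square if $1^{\mathfrak B}=B^2$,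 and faithful if distinct elements have distinct interpretations. A network $(V,f)$ is satisfiable in $\mathfrak B$ if there is $s\colon V\to B$ with $(s(x),s(y))\in f(x,y)^{\mathfrak B}$ for all $x,y\in V$, and satisfiable if it is satisfiable in some representation of $\mathbf A$. A representation is fully universal if every consistent atomic $\mathbf A$-network is satisfiable in it. An induced $a$-path on $4$ vertices in $(V,f)$ is a sequence of distinct vertices $v_0,\dots,v_3$ such that $f(v_i,v_j)=a$ if and only if $|i-j|=1$. A class $\mathcal C$ of networks has $\mathrm{AP}(k,l,m)$ if for all $(V_1,f_1),(V_2,f_2)\in\mathcal C$ with $|V_1|=k$, $|V_1\cap V_2|=l$, $|V_2|=m$ and $f_1=f_2$ on $(V_1\cap V_2)^2$ there is $(V_1\cup V_2,f)\in\mathcal C$ with $f=f_i$ on $V_i^2$ for $i=1,2$. It has the joint embedding property (JEP) if it has $\mathrm{AP}(k,0,m)$ for all $k,m\in\mathbb N$. Let $\mathcal C$ be the class of all finite consistent atomic $\mathbf A$-networks containing no induced $a$-path on $4$ vertices. Then: 1. $\mathcal C$ has the JEP. 2. $\mathcal C$ has $\mathrm{AP}(3,2,n)$ for every $n\in\mathbb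 N$. 3. There is a faithful square representation $\mathfrak B$ of $\mathbf A$ such that for every $\mathbf A$-network $(V,f)$ (in particular, for every atomic one) the following are equivalent: (a) $(V,f)$ is satisfiable; (b) $(V,f)$ is satisfiable in $\mathfrak B$; (c) there is $(V,g)\in\mathcal C$ with $g(x,y)\le f(x,y)$ for all $x,y\in V$. 4. The network $(P,f_P)$ with $P=\{0,1,2,3\}$, $f_P(i,i)=\mathrm{id}$, $f_P(0,1)=f_P(1,2)=f_P(2,3)=a$, $f_P(0,2)=f_P(0,3)=f_P(1,3)=r$ and $f_P(j,i)=f_P(i,j){\breve{\ }}$ is consistent and atomic, $0,1,2,3$ is an induced $a$-path in it, and it is unsatisfiable. 5. $\mathbf A$ has no fully universal representation. -/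

import Mathlib

universe u v w

/-- A relation algebra: a Boolean algebra with composition, converse and an identity element. -/
class RelationAlgebra (A : Type w) extends BooleanAlgebra A where
  /-- composition -/
  comp : A → A → A
  /-- converse -/
  conv : A → A
  /-- the identity element -/
  ident : A
  comp_assoc : ∀ a b c : A, comp (comp a b) c = comp a (comp b c)
  sup_comp : ∀ a b c : A, comp (a ⊔ b) c = comp a c ⊔ comp b c
  comp_ident : ∀ a : A, comp a ident = a
  conv_conv : ∀ a : A, conv (conv a) = a
  conv_sup : ∀ a b : A, conv (a ⊔ b) = conv a ⊔ conv b
  conv_comp : ∀ a b : A, conv (comp a b) = comp (conv b) (conv a)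
  compl_sup_conv_comp : ∀ a b : A, bᶜ ⊔ comp (conv a) (comp a b)ᶜ = bᶜ

namespace RelationAlgebra

/-- A representation of the relation algebra `A` with domain `B`. (The definition does not ask
for `rel` to be injective; see `Representation.Faithful`.) -/
structure Representation (A : Type w) [RelationAlgebra A] (B : Type u) where
  /-- the interpretation of the elements of `A` as binary relations on `B` -/
  rel : A → Set (B × B)
  rel_bot : rel ⊥ = ∅
  rel_top : rel ⊤ = ⋃ a : A, rel a
  rel_ident : rel ident = {p | p.1 = p.2}
  rel_compl : ∀ a : A, rel aᶜ = rel ⊤ \ rel a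
  rel_conv : ∀ a : A, rel (conv a) = {p | (p.2, p.1) ∈ rel a}
  rel_sup : ∀ a b : A, rel a ∪ rel b = rel (a ⊔ b)
  rel_comp : ∀ a b : A, {p | ∃ y, (p.1, y) ∈ rel a ∧ (y, p.2) ∈ rel b} = rel (comp a b)

/-- An `A`-network with vertex set `V`. Finiteness of `V` is asked for where networks are used. -/
abbrev Network (A : Type w) (V : Type v) : Type (max v w) := V → V → A

section
variable {A : Type w} [RelationAlgebra A]

/-- A representation is square if `1` is interpreted by the full relation. -/
def Representation.Square {B : Type u} (R : Representation A B) : Prop :=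
  R.rel ⊤ = Set.univ

/-- Distinct elements of the algebra are interpreted by distinct relations. -/
def Representation.Faithful {B : Type u} (R : Representation A B) : Prop :=
  Function.Injective R.rel

namespace Network

/-- All labels are atoms of `A`. -/
def Atomic {V : Type v} (f : Network A V) : Prop :=
  ∀ x y, IsAtom (f x y)

/-- Consistency (path consistency) of a network. -/
def Consistent {V : Type v} (f : Network A V) : Prop :=
  (∀ x y z, f x y ≤ comp (f x z) (f z y)) ∧ ∀ x, f x x ≤ ident

/-- Satisfiability in a given representation. -/
def SatisfiableIn {V : Type v} {B : Type u} (f : Network A V) (R : Representation A B) : Prop :=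
  ∃ s : V → B, ∀ x y, (s x, s y) ∈ R.rel (f x y)

/-- Satisfiability in some representation of `A` (square or not). -/
def Satisfiable {V : Type v} (f : Network A V) : Prop :=
  ∃ (B : Type u) (R : Representation A B), f.SatisfiableIn R

end Network

/-- Every finite consistent atomic network is satisfiable in the representation. -/
def Representation.FullyUniversal {B : Type u} (R : Representation A B) : Prop :=
  ∀ (V : Type v) [Finite V] (f : Network A V), f.Consistent → f.Atomic → f.SatisfiableIn R

/-- The `(k,l,m)`-amalgamation property of a class `C` of networks: two members of `C` with `k`
and `m` vertices, taken from any ambient type, whose vertex sets meet in `l` vertices and which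
agree there, have a common extension in `C` with vertex set `V₁ ∪ V₂`. -/
def AP (C : ∀ V : Type v, Network A V → Prop) (k l m : ℕ) : Prop :=
  ∀ (α : Type v) [DecidableEq α] (V₁ V₂ : Finset α) (f₁ : Network A V₁) (f₂ : Network A V₂),
    C V₁ f₁ → C V₂ f₂ → V₁.card = k → (V₁ ∩ V₂).card = l → V₂.card = m →
    (∀ (a b : α) (ha₁ : a ∈ V₁) (ha₂ : a ∈ V₂) (hb₁ : b ∈ V₁) (hb₂ : b ∈ V₂),
      f₁ ⟨a, ha₁⟩ ⟨b, hb₁⟩ = f₂ ⟨a, ha₂⟩ ⟨b, hb₂⟩) →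
    ∃ f : Network A (V₁ ∪ V₂ : Finset α), C (V₁ ∪ V₂ : Finset α) f ∧
      (∀ a b : V₁, f ⟨a, Finset.mem_union_left V₂ a.2⟩ ⟨b, Finset.mem_union_left V₂ b.2⟩
        = f₁ a b) ∧
      (∀ a b : V₂, f ⟨a, Finset.mem_union_right V₁ a.2⟩ ⟨b, Finset.mem_union_right V₁ b.2⟩
        = f₂ a b)

/-- The joint embedding property. -/
def JEP (C : ∀ V : Type v, Network A V → Prop) : Prop :=
  ∀ k m : ℕ, AP C k 0 m

end

end RelationAlgebra

open RelationAlgebra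

namespace RA1737

/-- The four atoms: the identity `e`, the symmetric diversity atom `a`, and the asymmetric
diversity atom `r` with its converse `rc`. -/
inductive Atom : Type
  | e | a | r | rc
  deriving DecidableEq

instance Atom.instFintype : Fintype Atom where
  elems := {Atom.e, Atom.a, Atom.r, Atom.rc}
  complete := by intro x; cases x <;> decide

/-- Converse on atoms. -/
def Atom.conv : Atom → Atom
  | .e => .e
  | .a => .a
  | .r => .rc
  | .rc => .r

open Atom

/-- The cycle `[x,y,z]` of a triple of atoms. -/
def cycle (t : Atom × Atom × Atom) : List (Atom × Atom × Atom) :=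
  let x := t.1
  let y := t.2.1
  let z := t.2.2
  [(x, y, z), (x.conv, z, y), (z, y.conv, x), (z.conv, x, y.conv), (y, z.conv, x.conv),
    (y.conv, x.conv, z.conv)]

/-- Representatives of the cycles of allowed triples: the cycles of the identity laws
`x ≤ x ∘ e`, and all cycles of diversity atoms other than that of `(r, r, a)`. -/
def allowedCycles : List (Atom × Atom × Atom) :=
  [(e, e, e), (a, e, a), (r, e, r), (rc, e, rc),
    (a, a, a), (r, r, r), (r, r, rc), (a, r, r), (r, a, r), (r, a, a)]

/-- `(x, y, z)` is an allowed triple, i.e. `z ≤ x ∘ y`. -/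
def Allowed (x y z : Atom) : Prop :=
  ∃ t ∈ allowedCycles, (x, y, z) ∈ cycle t

instance Allowed.decidable (x y z : Atom) : Decidable (Allowed x y z) :=
  inferInstanceAs (Decidable (∃ t ∈ allowedCycles, (x, y, z) ∈ cycle t))

theorem Atom.conv_conv (x : Atom) : x.conv.conv = x := by cases x <;> rfl

theorem allowed_ident : ∀ x z : Atom, Allowed x e z ↔ z = x := by decide

theorem allowed_conv : ∀ x y z : Atom, Allowed x y z.conv ↔ Allowed y.conv x.conv z := by decide

theorem allowed_cycle : ∀ x y z : Atom, Allowed x.conv y z ↔ Allowed x z y := by decide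

set_option maxRecDepth 100000 in
theorem allowed_assoc : ∀ x y z u : Atom,
    (∃ t, Allowed x y t ∧ Allowed t z u) ↔ (∃ t, Allowed y z t ∧ Allowed x t u) := by decide

/-- The relation algebra `17_37`; its elements are the sets of atoms. -/
abbrev Carrier : Type := Set Atom

instance instRelationAlgebra : RelationAlgebra Carrier where
  comp S T := {z | ∃ x ∈ S, ∃ y ∈ T, Allowed x y z}
  conv S := {x | x.conv ∈ S}
  ident := {e}
  comp_assoc S T U := by
    ext u
    constructor
    · rintro ⟨t, ⟨x, hx, y, hy, hxy⟩, z, hz, ht⟩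
      obtain ⟨s, h1, h2⟩ := (allowed_assoc x y z u).1 ⟨t, hxy, ht⟩
      exact ⟨x, hx, s, ⟨y, hy, z, hz, h1⟩, h2⟩
    · rintro ⟨x, hx, s, ⟨y, hy, z, hz, h1⟩, h2⟩
      obtain ⟨t, hxy, ht⟩ := (allowed_assoc x y z u).2 ⟨s, h1, h2⟩
      exact ⟨t, ⟨x, hx, y, hy, hxy⟩, z, hz, ht⟩
  sup_comp S T U := by
    ext u
    constructor
    · rintro ⟨x, hx | hx, h⟩
      · exact Or.inl ⟨x, hx, h⟩
      · exact Or.inr ⟨x, hx, h⟩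
    · rintro (⟨x, hx, h⟩ | ⟨x, hx, h⟩)
      · exact ⟨x, Or.inl hx, h⟩
      · exact ⟨x, Or.inr hx, h⟩
  comp_ident S := by
    ext u
    constructor
    · rintro ⟨x, hx, y, rfl, h⟩
      rw [(allowed_ident x u).1 h]
      exact hx
    · intro hu
      exact ⟨u, hu, e, rfl, (allowed_ident u u).2 rfl⟩
  conv_conv S := by
    ext x
    change x.conv.conv ∈ S ↔ x ∈ S
    rw [Atom.conv_conv]
  conv_sup S T := rfl
  conv_comp S T := by
    ext z
    constructor
    · rintro ⟨x, hx, y, hy, h⟩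
      refine ⟨y.conv, ?_, x.conv, ?_, (allowed_conv x y z).1 h⟩
      · change y.conv.conv ∈ T
        rwa [Atom.conv_conv]
      · change x.conv.conv ∈ S
        rwa [Atom.conv_conv]
    · rintro ⟨y, hy, x, hx, h⟩
      refine ⟨x.conv, hx, y.conv, hy, (allowed_conv x.conv y.conv z).2 ?_⟩
      rwa [Atom.conv_conv, Atom.conv_conv]
  compl_sup_conv_comp S T := by
    apply sup_eq_left.2
    rintro z ⟨x, hx, y, hy, h⟩ hz
    refine hy ⟨x.conv, hx, z, hz, ?_⟩
    rw [allowed_cycle]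
    exact h

/-- The sequence `p` of distinct vertices is an induced `a`-path in the network `f`. -/
def IsInducedAPath {V : Type v} {n : ℕ} (f : Network Carrier V) (p : Fin n → V) : Prop :=
  Function.Injective p ∧
    ∀ i j : Fin n, f (p i) (p j) = ({a} : Set Atom) ↔ |(i : ℤ) - (j : ℤ)| = 1

/-- The class of all finite consistent atomic networks with no induced `a`-path on 4 vertices. -/
def PathFree (V : Type v) (f : Network Carrier V) : Prop :=
  Finite V ∧ f.Consistent ∧ f.Atomic ∧ ¬ ∃ p : Fin 4 → V, IsInducedAPath f p

/-- The induced `a`-path on the vertices `0, 1, 2, 3`: the label of `(i, j)` is `e` if `i = j`,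
`a` if `i` and `j` are neighbours, `r` if `i + 2 ≤ j`, and the converse of `r` otherwise. -/
def aPath4 : Network Carrier (Fin 4) := fun i j =>
  if i = j then {e}
  else if (i : ℕ) + 1 = j ∨ (j : ℕ) + 1 = i then {a}
  else if i < j then {r}
  else {rc}

end RA1737

namespace RA1737

open Atom

/-! ### Consequences of the cycle conditions -/

/-! Everything follows from one fact: the networks with labels in $\mathcal C$ are exactly those
obtained by placing the vertices, not necessarily injectively, into one concrete structure.

Its points are finitely supported functions `ℤ → ℕ`, and a pair is labelled at the largest
coordinate where its points differ: `a` at even coordinates, an edge of a countable universal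
tournament at odd ones. A triangle is decided as in an ultrametric space, and the isosceles triples
are all allowed, so every triple of labels is allowed (`label_allowed`). As `ℤ` has no first or last
level, every allowed triple also has a witness (`exists_label_eq_of_allowed`), which makes the
structure a representation.

In any representation, four points never form an induced `a`-path (`isPathFree_of_mem_rel`).
Conversely, a graph with at least two vertices and no induced path on four vertices is disconnected,
or its complement is (`hasCut_or_hasCut`). Splitting `a`-edges this way again and again gives a tree
whose levels alternate between joins, realised at even coordinates, and tournaments of components,
realised at odd ones (`IsPathFree.exists_embedding`). Amalgamation then takes place inside the
structure, and the path on four vertices refutes full universality. -/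

theorem allowed_self_left : ∀ p q : Atom, p ≠ e → q ≠ e → Allowed p q q := by decide

theorem allowed_self_right : ∀ p q : Atom, p ≠ e → q ≠ e → Allowed p q p := by decide

theorem allowed_self_conv : ∀ p q : Atom, p ≠ e → Allowed p p.conv q := by decide

theorem allowed_ident_left : ∀ y z : Atom, Allowed e y z ↔ z = y := by decide

theorem eq_conv_of_allowed_ident : ∀ p q : Atom, Allowed p q e → q = p.conv := by decide

/-- The labelling by atoms is consistent and contains no induced `a`-path on four vertices. -/
structure IsPathFree {V : Type*} (g : V → V → Atom) : Prop where
  refl : ∀ x, g x x = e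
  allowed : ∀ x y z, Allowed (g x z) (g z y) (g x y)
  not_path : ∀ w x y z, g w x = a → g x y = a → g y z = a →
    g w y ≠ a → g w z ≠ a → g x z ≠ a → False

theorem IsPathFree.symm {V : Type*} {g : V → V → Atom} (h : IsPathFree g) (x y : V) :
    g y x = (g x y).conv :=
  eq_conv_of_allowed_ident _ _ (h.refl x ▸ h.allowed x x y)

theorem IsPathFree.comap {V W : Type*} {g : V → V → Atom} (h : IsPathFree g) (φ : W → V) :
    IsPathFree fun x y => g (φ x) (φ y) :=
  ⟨fun _ => h.refl _, fun _ _ _ => h.allowed _ _ _, fun _ _ _ _ => h.not_path _ _ _ _⟩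

theorem IsPathFree.congr_left {V : Type*} {g : V → V → Atom} (h : IsPathFree g) {x y : V}
    (hxy : g x y = e) (z : V) : g x z = g y z := by
  have := h.allowed x z y
  rwa [hxy, allowed_ident_left] at this

theorem IsPathFree.congr_right {V : Type*} {g : V → V → Atom} (h : IsPathFree g) {x y : V}
    (hxy : g x y = e) (z : V) : g z x = g z y := by
  rw [h.symm x z, h.symm y z, h.congr_left hxy]

theorem PathFree.exists_atoms {V : Type*} {f : Network Carrier V} (h : PathFree V f) :
    ∃ g : V → V → Atom, IsPathFree g ∧ ∀ x y, f x y = {g x y} := by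
  obtain ⟨-, hc, ha, hp⟩ := h
  choose g hg using fun x y => Set.isAtom_iff.1 (ha x y)
  have hall : ∀ x y z, Allowed (g x z) (g z y) (g x y) := by
    intro x y z
    have := hc.1 x y z
    rw [hg, hg, hg] at this
    obtain ⟨p, rfl, q, rfl, h⟩ := this rfl
    exact h
  have hrefl : ∀ x, g x x = e := by
    intro x
    have := hc.2 x
    rw [hg] at this
    exact this rfl
  have hsymm : ∀ x y, g y x = (g x y).conv := fun x y =>
    eq_conv_of_allowed_ident _ _ (hrefl x ▸ hall x x y)
  refine ⟨g, ⟨hrefl, hall, fun w x y z h1 h2 h3 h4 h5 h6 => hp ⟨![w, x, y, z], ?_, ?_⟩⟩, hg⟩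
  -- Distinctness need not be assumed in `not_path`: any coincidence among the four vertices
  -- contradicts the prescribed labels.
  · have n1 : w ≠ x := by rintro rfl; simp [hrefl] at h1
    have n2 : x ≠ y := by rintro rfl; simp [hrefl] at h2
    have n3 : y ≠ z := by rintro rfl; simp [hrefl] at h3
    have n4 : w ≠ y := by rintro rfl; exact h5 h3
    have n5 : x ≠ z := by rintro rfl; exact h5 h1
    have n6 : w ≠ z := by
      rintro rfl
      rw [hsymm w x, h1] at h6
      exact h6 rfl
    intro i j hij
    clear hsymm hall hrefl hg hp
    fin_cases i <;> fin_cases j <;> simp_all [n1.symm, n2.symm, n3.symm, n4.symm, n5.symm, n6.symm]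
  · have ha' : ∀ p : Atom, p.conv = a ↔ p = a := by decide
    intro i j
    rw [hg, Set.singleton_eq_singleton_iff]
    fin_cases i <;> fin_cases j <;>
      simp [hrefl, h1, h2, h3, h4, h5, h6, hsymm w x, hsymm w y, hsymm w z, hsymm x y, hsymm x z,
        hsymm y z, ha', show e ≠ a by decide]

theorem IsPathFree.pathFree {V : Type*} [Finite V] {g : V → V → Atom} (h : IsPathFree g) :
    PathFree V fun x y => ({g x y} : Set Atom) := by
  refine ⟨inferInstance, ⟨?_, ?_⟩, fun x y => Set.isAtom_singleton _, ?_⟩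
  · rintro x y z _ rfl
    exact ⟨_, rfl, _, rfl, h.allowed x y z⟩
  · rintro x _ rfl
    exact h.refl x
  · rintro ⟨p, -, hp⟩
    simp only [Set.singleton_eq_singleton_iff] at hp
    refine h.not_path (p 0) (p 1) (p 2) (p 3) ?_ ?_ ?_ ?_ ?_ ?_ <;>
      simp [hp]

/-! ### Networks satisfiable in a representation -/

section Representation

variable {B : Type*} (R : Representation Carrier B)

theorem rel_mono {S T : Carrier} (h : S ≤ T) : R.rel S ⊆ R.rel T := by
  rw [← sup_eq_right.2 h, ← R.rel_sup]
  exact Set.subset_union_left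

theorem exists_atom_mem_rel {S : Carrier} {p : B × B} (h : p ∈ R.rel S) :
    ∃ t ∈ S, p ∈ R.rel {t} := by
  induction S, S.toFinite using Set.Finite.induction_on with
  | empty =>
    have := R.rel_bot
    exact absurd (this ▸ h : p ∈ (∅ : Set (B × B))) (Set.notMem_empty p)
  | @insert t S _ _ ih =>
    have : R.rel (insert t S) = R.rel {t} ∪ R.rel S := (R.rel_sup {t} S).symm
    rw [this] at h
    rcases h with h | h
    · exact ⟨t, Set.mem_insert t S, h⟩
    · obtain ⟨t', ht', h'⟩ := ih h
      exact ⟨t', Set.mem_insert_of_mem t ht', h'⟩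

theorem atom_unique {t t' : Atom} {p : B × B} (h : p ∈ R.rel {t}) (h' : p ∈ R.rel {t'}) :
    t = t' := by
  by_contra hne
  have : p ∈ R.rel ({t}ᶜ : Set Atom) := by
    refine rel_mono R ?_ h'
    rintro _ rfl
    exact fun h => hne h.symm
  rw [R.rel_compl] at this
  exact this.2 h

theorem allowed_of_mem_rel {x y z : B} {p q t : Atom} (hp : (x, z) ∈ R.rel {p})
    (hq : (z, y) ∈ R.rel {q}) (ht : (x, y) ∈ R.rel {t}) : Allowed p q t := by
  have : (x, y) ∈ R.rel (RelationAlgebra.comp {p} {q}) := by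
    rw [← R.rel_comp]
    exact ⟨z, hp, hq⟩
  obtain ⟨t', ⟨_, rfl, _, rfl, h⟩, ht'⟩ := exists_atom_mem_rel R this
  rwa [atom_unique R ht ht']

theorem exists_mem_rel_of_allowed {x y : B} {p q t : Atom} (ht : (x, y) ∈ R.rel {t})
    (h : Allowed p q t) : ∃ z, (x, z) ∈ R.rel {p} ∧ (z, y) ∈ R.rel {q} := by
  have : (x, y) ∈ R.rel (RelationAlgebra.comp {p} {q}) := by
    refine rel_mono R ?_ ht
    rintro _ rfl
    exact ⟨p, rfl, q, rfl, h⟩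
  rw [← R.rel_comp] at this
  exact this

/-- A representation need not be square, so a pair of points may carry no label at all; pairs joined
through a third point do carry one. -/
theorem exists_atom_trans {x y z : B} {p q : Atom} (hp : (x, z) ∈ R.rel {p})
    (hq : (z, y) ∈ R.rel {q}) : ∃ t, (x, y) ∈ R.rel {t} := by
  have : (x, y) ∈ R.rel (RelationAlgebra.comp {p} {q}) := by
    rw [← R.rel_comp]
    exact ⟨z, hp, hq⟩
  obtain ⟨t, -, ht⟩ := exists_atom_mem_rel R this
  exact ⟨t, ht⟩

/-- Moving one end of a pair along an `a`-edge cannot turn `r` into `rc`, because `(r, a, rc)` and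
`(a, r, rc)` are forbidden. -/
theorem path_labels_eq : ∀ s t u : Atom, s ≠ a → t ≠ a → u ≠ a → Allowed s a t → Allowed a u t →
    s = t ∧ u = t ∧ t ≠ e := by decide

/-- The conditions on `u` force `u = t.conv` and those on `v` force `v = t`, but then `(a, u, v)`
lies in the forbidden cycle. -/
theorem path_witness_contradiction : ∀ t u v : Atom, t ≠ a → t ≠ e → Allowed t t u →
    Allowed u t a → Allowed a t v → Allowed v t t.conv → Allowed a u v → False := by decide

/-- Four points of a representation never form an induced `a`-path: if they did, with `t` the
common label of `(0, 2)`, `(0, 3)`, `(1, 3)`, a point completing `(0, 3)` to a cyclic triangle with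
labels `t` could not be related to `1` and `2`. -/
theorem isPathFree_of_mem_rel {V : Type*} (s : V → B) (g : V → V → Atom)
    (h : ∀ x y, (s x, s y) ∈ R.rel {g x y}) : IsPathFree g := by
  have hall : ∀ x y z, Allowed (g x z) (g z y) (g x y) := fun x y z =>
    allowed_of_mem_rel R (h x z) (h z y) (h x y)
  have hrefl : ∀ x, g x x = e := by
    intro x
    refine atom_unique R (h x x) ?_
    have := R.rel_ident
    exact (this ▸ rfl : (s x, s x) ∈ R.rel RelationAlgebra.ident)
  have hsymm : ∀ x y, g y x = (g x y).conv := fun x y =>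
    eq_conv_of_allowed_ident _ _ (hrefl x ▸ hall x x y)
  refine ⟨hrefl, hall, fun w x y z h1 h2 h3 h4 h5 h6 => ?_⟩
  obtain ⟨e1, e2, he⟩ := path_labels_eq (g w y) (g w z) (g x z) h4 h5 h6
    (h3 ▸ hall w z y) (h1 ▸ hall w z x)
  have hcyc : ∀ t : Atom, t ≠ a → t ≠ e → Allowed t t t.conv := by decide
  obtain ⟨b, hb, hb'⟩ := exists_mem_rel_of_allowed R (h z w) (p := g w z) (q := g w z)
    (hsymm w z ▸ hcyc _ h5 he)
  obtain ⟨u, hu⟩ := exists_atom_trans R (h x z) hb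
  obtain ⟨v, hv⟩ := exists_atom_trans R (h y z) hb
  refine path_witness_contradiction (g w z) u v h5 he ?_
    ?_ (h3 ▸ allowed_of_mem_rel R (h y z) hb hv) ?_ ?_
  · have := allowed_of_mem_rel R (h x z) hb hu
    rwa [e2] at this
  · have := allowed_of_mem_rel R hu hb' (h x w)
    rwa [hsymm w x, h1] at this
  · have := allowed_of_mem_rel R hv hb' (h y w)
    rwa [hsymm w y, e1] at this
  · have := allowed_of_mem_rel R (h y x) hu hv
    rwa [hsymm x y, h2] at this

theorem exists_pathFree_le {V : Type*} [Finite V] {f : Network Carrier V}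
    (h : f.SatisfiableIn R) :
    ∃ g : Network Carrier V, PathFree V g ∧ ∀ x y, g x y ≤ f x y := by
  obtain ⟨s, hs⟩ := h
  choose g hg hgs using fun x y => exists_atom_mem_rel R (hs x y)
  exact ⟨_, (isPathFree_of_mem_rel R s g hgs).pathFree,
    fun x y => Set.singleton_subset_iff.2 (hg x y)⟩

theorem pathFree_of_satisfiableIn {V : Type*} [Finite V] {f : Network Carrier V}
    (h : f.SatisfiableIn R) (ha : f.Atomic) : PathFree V f := by
  obtain ⟨g, hg, hle⟩ := exists_pathFree_le R h
  have : g = f := by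
    funext x y
    exact ((ha x y).le_iff_eq (hg.2.2.1 x y).1).1 (hle x y)
  rwa [← this]

/-- A representation transported to a lifted domain. -/
def uliftRepresentation : Representation Carrier (ULift B) where
  rel S := {p | (p.1.down, p.2.down) ∈ R.rel S}
  rel_bot := by
    ext p
    exact Set.ext_iff.1 R.rel_bot (p.1.down, p.2.down)
  rel_top := by
    ext p
    refine (Set.ext_iff.1 R.rel_top (p.1.down, p.2.down)).trans ?_
    simp only [Set.mem_iUnion, Set.mem_ofPred_eq]
  rel_ident := by
    ext ⟨⟨x⟩, ⟨y⟩⟩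
    simp [R.rel_ident]
  rel_compl S := by
    ext p
    simp [R.rel_compl]
  rel_conv S := by
    ext p
    simp [R.rel_conv]
  rel_sup S T := by
    ext p
    rw [← R.rel_sup]
    rfl
  rel_comp S T := by
    ext p
    rw [← R.rel_comp]
    exact ⟨fun ⟨y, h⟩ => ⟨y.down, h⟩, fun ⟨y, h⟩ => ⟨⟨y⟩, h⟩⟩

end Representation

/-! ### A countable universal tournament -/

/-- A tournament on `ℕ`: for `m < n` the edge points from `m` to `n` iff the `m`-th binary digit
of `n` is `1`. -/
def Dominates (m n : ℕ) : Prop :=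
  (m < n ∧ n.testBit m = true) ∨ (n < m ∧ m.testBit n = false)

theorem dominates_comm {m n : ℕ} (h : m ≠ n) : Dominates n m ↔ ¬ Dominates m n := by
  unfold Dominates
  rcases lt_or_gt_of_ne h with h | h
  · simp [h, h.not_gt]
  · simp [h, h.not_gt]

/-- The extension property of the tournament: the binary digits of `n` can be prescribed freely at
the positions in `U`. -/
theorem exists_dominates_iff (U : Finset ℕ) (P : ℕ → Prop) :
    ∃ n, n ∉ U ∧ ∀ u ∈ U, Dominates u n ↔ P u := by
  classical
  obtain ⟨M, hM⟩ := Finset.exists_le U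
  -- The extra digit at `M + 1` makes `n` larger than every element of `U`, so that its digits
  -- decide all these edges.
  set n := Nat.ofBits fun i : Fin (M + 2) => decide ((i : ℕ) = M + 1 ∨ P i) with hn
  have htop : n.testBit (M + 1) = true := by
    rw [hn, Nat.testBit_ofBits_lt _ _ (by omega)]
    simp
  have hlt : M + 1 < n := Nat.lt_two_pow_self.trans_le (Nat.ge_two_pow_of_testBit htop)
  refine ⟨n, fun h => by have := hM n h; omega, fun u hu => ?_⟩
  have hu' := hM u hu
  have h1 : u < n := by omega
  have h2 : n.testBit u = decide (P u) := by
    rw [hn, Nat.testBit_ofBits_lt _ _ (by omega)]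
    have : u ≠ M + 1 := by omega
    simp [this]
  simp [Dominates, h1, h1.not_gt, h2]

theorem exists_tournament_embedding {Q : Type*} [Finite Q] (D : Q → Q → Prop)
    (hD : ∀ x y, x ≠ y → (D y x ↔ ¬ D x y)) :
    ∃ t : Q → ℕ, ∀ x y, x ≠ y → t x ≠ t y ∧ (Dominates (t x) (t y) ↔ D x y) := by
  classical
  have := Fintype.ofFinite Q
  suffices h : ∀ s : Finset Q, ∃ t : Q → ℕ, ∀ x ∈ s, ∀ y ∈ s, x ≠ y →
      t x ≠ t y ∧ (Dominates (t x) (t y) ↔ D x y) by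
    obtain ⟨t, ht⟩ := h Finset.univ
    exact ⟨t, fun x y => ht x (Finset.mem_univ x) y (Finset.mem_univ y)⟩
  intro s
  induction s using Finset.induction_on with
  | empty => exact ⟨fun _ => 0, by simp⟩
  | insert q s hq ih =>
    obtain ⟨t, ht⟩ := ih
    obtain ⟨n, hn, hn'⟩ := exists_dominates_iff (s.image t) fun m => ∃ x ∈ s, t x = m ∧ D x q
    have hne : ∀ x ∈ s, t x ≠ n := by
      rintro x hx rfl
      exact hn (Finset.mem_image_of_mem t hx)
    have hdom : ∀ x ∈ s, Dominates (t x) n ↔ D x q := by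
      intro x hx
      rw [hn' _ (Finset.mem_image_of_mem t hx)]
      refine ⟨?_, fun h => ⟨x, hx, rfl, h⟩⟩
      rintro ⟨y, hy, hyx, h⟩
      by_cases hxy : y = x
      · rwa [← hxy]
      · exact absurd hyx (ht y hy x hx hxy).1
    have hsq : ∀ x ∈ s, x ≠ q := by
      rintro x hx rfl
      exact hq hx
    refine ⟨Function.update t q n, ?_⟩
    intro x hx y hy hxy
    rcases Finset.mem_insert.1 hx with rfl | hx' <;> rcases Finset.mem_insert.1 hy with rfl | hy'
    · exact absurd rfl hxy
    · rw [Function.update_self, Function.update_of_ne (hsq y hy'), dominates_comm (hne y hy'),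
        hdom y hy', hD y x hxy.symm]
      exact ⟨(hne y hy').symm, Iff.rfl⟩
    · rw [Function.update_self, Function.update_of_ne (hsq x hx')]
      exact ⟨hne x hx', hdom x hx'⟩
    · rw [Function.update_of_ne (hsq x hx'), Function.update_of_ne (hsq y hy')]
      exact ht x hx' y hy' hxy

/-! ### The universal representation -/

/-- The label contributed by a level: even levels are `a`-cliques, odd levels carry the universal
tournament. -/
noncomputable def levelLabel (i : ℤ) (m n : ℕ) : Atom :=
  open Classical in if Even i then a else if Dominates m n then r else rc

theorem levelLabel_ne_e (i : ℤ) (m n : ℕ) : levelLabel i m n ≠ e := by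
  unfold levelLabel
  split_ifs <;> decide

theorem levelLabel_eq_a_iff (i : ℤ) (m n : ℕ) : levelLabel i m n = a ↔ Even i := by
  unfold levelLabel
  split_ifs with h <;> simp [h]

theorem levelLabel_symm (i : ℤ) {m n : ℕ} (h : m ≠ n) :
    levelLabel i n m = (levelLabel i m n).conv := by
  unfold levelLabel
  rw [dominates_comm h]
  split_ifs <;> rfl

theorem exists_levelLabel_eq {i : ℤ} {p q : Atom} (hp : p ≠ e) (hq : q ≠ e)
    (hpi : p = a ↔ Even i) (hqi : q = a ↔ Even i) {m m' : ℕ} (h : m = m' → q = p.conv) :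
    ∃ n, m ≠ n ∧ n ≠ m' ∧ levelLabel i m n = p ∧ levelLabel i n m' = q := by
  -- `q` labels the pair `(n, m')`, so `q = rc` asks for an edge from `m'` to `n`. When `m = m'`,
  -- the hypothesis `h` makes the two demands agree.
  obtain ⟨n, hn, hdom⟩ := exists_dominates_iff {m, m'} fun u =>
    (u = m ∧ p = r) ∨ (u = m' ∧ q = rc)
  simp only [Finset.mem_insert, Finset.mem_singleton, not_or] at hn hdom
  have h1 := hdom m (Or.inl rfl)
  have h2 := hdom m' (Or.inr rfl)
  refine ⟨n, Ne.symm hn.1, hn.2, ?_⟩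
  unfold levelLabel
  rw [dominates_comm (Ne.symm hn.2), h1, h2]
  by_cases hi : Even i
  · simp [hi, hpi.2 hi, hqi.2 hi]
  · have hp' := mt hpi.1 hi
    have hq' := mt hqi.1 hi
    by_cases hm : m = m'
    · have := h hm
      subst hm this
      cases p <;> simp_all [Atom.conv]
    · have hm' : ¬ m' = m := fun h => hm h.symm
      cases p <;> cases q <;> simp_all

/-- The domain of the universal representation. -/
abbrev Point : Type := ℤ →₀ ℕ

/-- The label of a pair of points: it is decided at the largest level where they differ. -/
noncomputable def label (x y : Point) : Atom :=
  open Classical in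
  if h : ∃ i, x i ≠ y i ∧ ∀ j > i, x j = y j then
    levelLabel h.choose (x h.choose) (y h.choose) else e

theorem label_eq {x y : Point} {i : ℤ} (h : x i ≠ y i) (h' : ∀ j > i, x j = y j) :
    label x y = levelLabel i (x i) (y i) := by
  have hex : ∃ i, x i ≠ y i ∧ ∀ j > i, x j = y j := ⟨i, h, h'⟩
  rw [label, dif_pos hex]
  obtain ⟨hc, hc'⟩ := hex.choose_spec
  have : hex.choose = i := by
    rcases lt_trichotomy hex.choose i with hlt | heq | hgt
    · exact absurd (hc' i hlt) h
    · exact heq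
    · exact absurd (h' _ hgt) hc
  rw [this]

theorem label_self (x : Point) : label x x = e := by simp [label]

theorem exists_max_ne {x y : Point} (h : x ≠ y) : ∃ i, x i ≠ y i ∧ ∀ j > i, x j = y j := by
  have hne : (x.neLocus y).Nonempty := Finsupp.nonempty_neLocus_iff.2 h
  refine ⟨(x.neLocus y).max' hne, Finsupp.mem_neLocus.1 (Finset.max'_mem _ hne), fun j hj => ?_⟩
  by_contra hxy
  exact absurd (Finset.le_max' _ j (Finsupp.mem_neLocus.2 hxy)) hj.not_ge

theorem label_eq_e_iff {x y : Point} : label x y = e ↔ x = y := by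
  refine ⟨fun h => ?_, fun h => h ▸ label_self x⟩
  by_contra hne
  obtain ⟨i, hi, hi'⟩ := exists_max_ne hne
  rw [label_eq hi hi'] at h
  exact levelLabel_ne_e _ _ _ h

theorem label_symm (x y : Point) : label y x = (label x y).conv := by
  by_cases h : x = y
  · rw [h, label_self]
    rfl
  · obtain ⟨i, hi, hi'⟩ := exists_max_ne h
    rw [label_eq hi hi', label_eq hi.symm fun j hj => (hi' j hj).symm, levelLabel_symm i hi]

theorem label_allowed (x y z : Point) : Allowed (label x z) (label z y) (label x y) := by
  by_cases hxz : x = z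
  · subst hxz
    rw [label_self, allowed_ident_left]
  by_cases hzy : z = y
  · subst hzy
    rw [label_self, allowed_ident]
  have hxz' := mt label_eq_e_iff.1 hxz
  have hzy' := mt label_eq_e_iff.1 hzy
  obtain ⟨i, hi, hi'⟩ := exists_max_ne hxz
  obtain ⟨j, hj, hj'⟩ := exists_max_ne hzy
  rcases lt_trichotomy i j with hij | rfl | hij
  -- The higher level decides: below it, `x` and `z` cannot be told apart from `y`.
  · have : label x y = label z y := by
      rw [label_eq hj hj', label_eq (i := j), hi' j hij]
      · rwa [hi' j hij]
      · exact fun k hk => (hi' k (hij.trans hk)).trans (hj' k hk)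
    rw [this]
    exact allowed_self_left _ _ hxz' hzy'
  · by_cases hxy : x i = y i
    · have : label z y = (label x z).conv := by
        rw [label_eq hj hj', label_eq hi hi', ← hxy, levelLabel_symm i hi]
      rw [this]
      exact allowed_self_conv _ _ hxz'
    · have hxy' := label_eq hxy fun k hk => (hi' k hk).trans (hj' k hk)
      -- All three labels now come from the same level, so either all or none of them are `a`; no
      -- forbidden triple is of this kind.
      have key : ∀ p q t : Atom, p ≠ e → q ≠ e → t ≠ e → (p = a ↔ t = a) → (q = a ↔ t = a) →
          Allowed p q t := by decide
      refine key _ _ _ hxz' hzy' ?_ ?_ ?_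
      · rw [hxy']
        exact levelLabel_ne_e _ _ _
      · rw [hxy', label_eq hi hi', levelLabel_eq_a_iff, levelLabel_eq_a_iff]
      · rw [hxy', label_eq hj hj', levelLabel_eq_a_iff, levelLabel_eq_a_iff]
  · have : label x y = label x z := by
      rw [label_eq hi hi', label_eq (i := i), hj' i hij]
      · rwa [← hj' i hij]
      · exact fun k hk => (hi' k hk).trans (hj' k (hij.trans hk))
    rw [this]
    exact allowed_self_right _ _ hxz' hzy'

theorem label_update (x : Point) {i : ℤ} {n : ℕ} (h : x i ≠ n) :
    label x (x.update i n) = levelLabel i (x i) n := by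
  rw [label_eq (i := i)]
  · simp
  · simpa using h
  · intro j hj
    simp [Function.update_of_ne hj.ne']

theorem exists_label_eq_of_allowed {x y : Point} {p q : Atom} (h : Allowed p q (label x y)) :
    ∃ w, label x w = p ∧ label w y = q := by
  by_cases hp : p = e
  · rw [hp, allowed_ident_left] at h
    exact ⟨x, hp ▸ label_self x, h⟩
  by_cases hq : q = e
  · rw [hq, allowed_ident] at h
    exact ⟨y, h, hq ▸ label_self y⟩
  have hconv : ∀ p : Atom, p ≠ e → p.conv ≠ e ∧ (p.conv = a ↔ p = a) := by decide
  by_cases hxy : x = y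
  · subst hxy
    rw [label_self] at h
    obtain rfl := eq_conv_of_allowed_ident p q h
    -- Any level of the right parity would do when `x = y`.
    obtain ⟨i, hi⟩ : ∃ i : ℤ, p = a ↔ Even i := by
      by_cases hpa : p = a
      · exact ⟨0, by simp [hpa]⟩
      · exact ⟨1, by simp [hpa]⟩
    obtain ⟨n, hn, -, h1, -⟩ := exists_levelLabel_eq hp hq hi ((hconv p hp).2.trans hi) (m := x i)
      (m' := x i) fun _ => rfl
    have h3 := (label_update x hn).trans h1
    exact ⟨_, h3, by rw [label_symm, h3]⟩
  obtain ⟨i, hi, hi'⟩ := exists_max_ne hxy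
  have hl := label_eq hi hi'
  have hz : label x y ≠ e := mt label_eq_e_iff.1 hxy
  have hza : label x y = a ↔ Even i := by rw [hl, levelLabel_eq_a_iff]
  -- The level at which the witness branches off depends on which of `p`, `q` fit the parity of `i`:
  -- level `i` itself if both fit, the level below it if exactly one does, the level above it if
  -- neither does.
  by_cases hpi : p = a ↔ Even i <;> by_cases hqi : q = a ↔ Even i
  · obtain ⟨n, h1, h2, h3, h4⟩ := exists_levelLabel_eq hp hq hpi hqi (m := x i) (m' := y i)
      fun h => absurd h hi
    refine ⟨x.update i n, (label_update x h1).trans h3, ?_⟩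
    rw [label_eq (i := i)]
    · simpa using h4
    · simpa using h2
    · intro j hj
      simp [Function.update_of_ne hj.ne', hi' j hj]
  · have hpz : ∀ p q z : Atom, q ≠ e → z ≠ e → (p = a ↔ z = a) → ¬ (q = a ↔ z = a) →
      Allowed p q z → p = z := by decide
    -- With `p` equal to the label of `(x, y)`, the witness may be a copy of `y` altered below level
    -- `i`: this leaves the label from `x` unchanged and makes the label to `y` free.
    obtain rfl := hpz p q _ hq hz (hpi.trans hza.symm) (fun h => hqi (h.trans hza)) h
    have hqi' : q = a ↔ Even (i - 1) := by
      rw [Int.even_sub_one]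
      tauto
    obtain ⟨n, h1, -, h3, -⟩ := exists_levelLabel_eq (hconv q hq).1 hq ((hconv q hq).2.trans hqi')
      hqi' (m := y (i - 1)) (m' := y (i - 1)) fun _ => (Atom.conv_conv q).symm
    have h4 := (label_update y h1).trans h3
    refine ⟨y.update (i - 1) n, ?_, by rw [label_symm, h4, Atom.conv_conv]⟩
    have hne : i ≠ i - 1 := by omega
    rw [hl, label_eq (i := i)]
    · simp [Function.update_of_ne hne]
    · simpa [Function.update_of_ne hne] using hi
    · intro j hj
      have hne : j ≠ i - 1 := by omega
      simp [Function.update_of_ne hne, hi' j hj]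
  · have hqz : ∀ p q z : Atom, p ≠ e → z ≠ e → (q = a ↔ z = a) → ¬ (p = a ↔ z = a) →
      Allowed p q z → q = z := by decide
    obtain rfl := hqz p q _ hp hz (hqi.trans hza.symm) (fun h => hpi (h.trans hza)) h
    have hpi' : p = a ↔ Even (i - 1) := by
      rw [Int.even_sub_one]
      tauto
    obtain ⟨n, h1, -, h3, -⟩ := exists_levelLabel_eq hp (hconv p hp).1 hpi'
      ((hconv p hp).2.trans hpi') (m := x (i - 1)) (m' := x (i - 1)) fun _ => rfl
    refine ⟨x.update (i - 1) n, (label_update x h1).trans h3, ?_⟩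
    have hne : i ≠ i - 1 := by omega
    rw [hl, label_eq (i := i)]
    · simp [Function.update_of_ne hne]
    · simpa [Function.update_of_ne hne] using hi
    · intro j hj
      have hne : j ≠ i - 1 := by omega
      simp [Function.update_of_ne hne, hi' j hj]
  · have hpq : ∀ p q z : Atom, p ≠ e → q ≠ e → z ≠ e → ¬ (p = a ↔ z = a) → ¬ (q = a ↔ z = a) →
      Allowed p q z → q = p.conv := by decide
    -- Here `q = p.conv`. This is what is needed above level `i`, where `x` and `y` agree and must
    -- see the witness in the same way.
    have hqp := hpq p q _ hp hq hz (fun h => hpi (h.trans hza)) (fun h => hqi (h.trans hza)) h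
    have hpi' : p = a ↔ Even (i + 1) := by
      rw [Int.even_add_one]
      tauto
    have hqi' : q = a ↔ Even (i + 1) := by
      rw [Int.even_add_one]
      tauto
    obtain ⟨n, h1, h2, h3, h4⟩ := exists_levelLabel_eq hp hq hpi' hqi' (m := x (i + 1))
      (m' := y (i + 1)) fun _ => hqp
    refine ⟨x.update (i + 1) n, (label_update x h1).trans h3, ?_⟩
    rw [label_eq (i := i + 1)]
    · simpa using h4
    · simpa using h2
    · intro j hj
      rw [Finsupp.coe_update, Function.update_of_ne hj.ne']
      exact hi' j (by omega)

/-- The universal representation of `17_37`. -/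
noncomputable def universalRepresentation : Representation Carrier Point where
  rel S := {p | label p.1 p.2 ∈ S}
  rel_bot := rfl
  rel_top := Set.Subset.antisymm (fun p _ => Set.mem_iUnion.2 ⟨⊤, trivial⟩) fun _ _ => trivial
  rel_ident := by
    ext p
    exact label_eq_e_iff
  rel_compl S := by
    ext p
    exact ⟨fun h => ⟨trivial, h⟩, fun h => h.2⟩
  rel_conv S := by
    ext p
    change (label p.1 p.2).conv ∈ S ↔ label p.2 p.1 ∈ S
    rw [label_symm p.1 p.2]
  rel_sup S T := rfl
  rel_comp S T := by
    ext p
    constructor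
    · rintro ⟨y, h1, h2⟩
      exact ⟨_, h1, _, h2, label_allowed _ _ _⟩
    · rintro ⟨s, hs, t, ht, h⟩
      obtain ⟨w, rfl, rfl⟩ := exists_label_eq_of_allowed h
      exact ⟨w, hs, ht⟩

theorem universalRepresentation_square : universalRepresentation.Square := rfl

theorem universalRepresentation_faithful : universalRepresentation.Faithful := by
  intro S T h
  ext p
  -- Every atom labels some pair starting at `0`, so a set of atoms can be recovered from its
  -- interpretation.
  have hp : ∀ p : Atom, Allowed p p.conv e := by decide
  obtain ⟨w, hw, -⟩ := exists_label_eq_of_allowed (x := 0) (y := 0) (label_self 0 ▸ hp p)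
  have := Set.ext_iff.1 h ((0 : Point), w)
  change label 0 w ∈ S ↔ label 0 w ∈ T at this
  rwa [hw] at this

/-! ### Cuts of graphs without induced paths on four vertices -/

/-- `S` splits into two nonempty parts all of whose cross pairs are related by `E`. -/
def HasCut {V : Type*} (E : V → V → Prop) (S : Set V) : Prop :=
  ∃ P : Set V, (∃ x ∈ S, x ∈ P) ∧ (∃ y ∈ S, y ∉ P) ∧ ∀ x ∈ S, x ∈ P → ∀ y ∈ S, y ∉ P → E x y

/-- The induction step of Seinsche's theorem. If `v` has `G`-neighbours on both sides of the cut and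
also a non-neighbour, its non-neighbours form one side of a new `H`-cut: a `G`-edge from a
non-neighbour `x` to a neighbour `y` on the same old side would continue through `v` to a neighbour
on the other side, giving an induced path. -/
theorem HasCut.insert {V : Type*} {G H : V → V → Prop} (hG : ∀ x y, G x y → G y x)
    (hH : ∀ x y, H x y → H y x) (hGH : ∀ x y, x ≠ y → G x y ∨ H x y)
    (hP : ∀ w x y z, G w x → G x y → G y z → H w y → H w z → H x z → False)
    {S : Set V} {v : V} (hv : v ∉ S) (hS : HasCut H S) :
    HasCut G (insert v S) ∨ HasCut H (insert v S) := by
  obtain ⟨P, ⟨p, hpS, hp⟩, ⟨q, hqS, hq⟩, hPH⟩ := hS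
  have hne : ∀ x ∈ S, x ≠ v := by
    rintro x hx rfl
    exact hv hx
  have hor : ∀ x ∈ S, ¬ G v x → H v x := fun x hx h => (hGH v x (hne x hx).symm).resolve_left h
  by_cases h1 : ∀ x ∈ S, G v x
  · refine Or.inl ⟨{v}, ⟨v, Set.mem_insert v S, rfl⟩, ⟨p, Set.mem_insert_of_mem v hpS, hne p hpS⟩,
      ?_⟩
    rintro x - rfl y (rfl | hy) hyv
    · exact absurd rfl hyv
    · exact h1 y hy
  refine Or.inr ?_
  by_cases h2 : ∀ x ∈ S, x ∈ P → ¬ G v x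
  · refine ⟨S ∩ P, ⟨p, Set.mem_insert_of_mem v hpS, hpS, hp⟩, ⟨v, Set.mem_insert v S,
      fun h => hv h.1⟩, ?_⟩
    rintro x - ⟨hxS, hx⟩ y (rfl | hyS) hy
    · exact hH _ _ (hor x hxS (h2 x hxS hx))
    · exact hPH x hxS hx y hyS fun h => hy ⟨hyS, h⟩
  by_cases h3 : ∀ x ∈ S, x ∉ P → ¬ G v x
  · refine ⟨S \ P, ⟨q, Set.mem_insert_of_mem v hqS, hqS, hq⟩, ⟨v, Set.mem_insert v S,
      fun h => hv h.1⟩, ?_⟩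
    rintro x - ⟨hxS, hx⟩ y (rfl | hyS) hy
    · exact hH _ _ (hor x hxS (h3 x hxS hx))
    · refine hH _ _ (hPH y hyS ?_ x hxS hx)
      by_contra h
      exact hy ⟨hyS, h⟩
  push Not at h1 h2 h3
  obtain ⟨n, hnS, hn⟩ := h1
  obtain ⟨u, huS, hu, hvu⟩ := h2
  obtain ⟨u', huS', hu', hvu'⟩ := h3
  refine ⟨{x | x ∈ S ∧ ¬ G v x}, ⟨n, Set.mem_insert_of_mem v hnS, hnS, hn⟩,
    ⟨v, Set.mem_insert v S, fun h => hv h.1⟩, ?_⟩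
  rintro x - ⟨hxS, hx⟩ y (rfl | hyS) hy
  · exact hH _ _ (hor x hxS hx)
  have hvy : G v y := by
    by_contra h
    exact hy ⟨hyS, h⟩
  have hxy : x ≠ y := by
    rintro rfl
    exact hx hvy
  have hxv := hH _ _ (hor x hxS hx)
  by_cases hxP : x ∈ P <;> by_cases hyP : y ∈ P
  · exact (hGH x y hxy).resolve_left fun hGxy => hP x y v u' hGxy (hG _ _ hvy) hvu' hxv
      (hPH x hxS hxP u' huS' hu') (hPH y hyS hyP u' huS' hu')
  · exact hPH x hxS hxP y hyS hyP
  · exact hH _ _ (hPH y hyS hyP x hxS hxP)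
  · exact (hGH x y hxy).resolve_left fun hGxy => hP x y v u hGxy (hG _ _ hvy) hvu hxv
      (hH _ _ (hPH u huS hu x hxS hxP)) (hH _ _ (hPH u huS hu y hyS hyP))

theorem hasCut_or_hasCut {V : Type*} {G H : V → V → Prop} (hG : ∀ x y, G x y → G y x)
    (hH : ∀ x y, H x y → H y x) (hGH : ∀ x y, x ≠ y → G x y ∨ H x y)
    (hP : ∀ w x y z, G w x → G x y → G y z → H w y → H w z → H x z → False)
    (S : Finset V) (hS : (S : Set V).Nontrivial) : HasCut G (S : Set V) ∨ HasCut H (S : Set V) := by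
  classical
  induction S using Finset.induction_on with
  | empty => simp at hS
  | insert v S hv ih =>
    rw [Finset.coe_insert] at hS ⊢
    by_cases hS' : (S : Set V).Nontrivial
    · rcases ih hS' with h | h
      · refine (h.insert hH hG (fun x y h => (hGH x y h).symm) ?_ (Finset.mem_coe.not.2 hv)).symm
        intro w x y z h1 h2 h3 h4 h5 h6
        -- The complement of a path on four vertices is again such a path, which allows `G` and `H`
        -- to be swapped.
        exact hP x z w y h6 (hG _ _ h5) h4 (hH _ _ h1) h2 (hH _ _ h3)
      · exact h.insert hG hH hGH hP (Finset.mem_coe.not.2 hv)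
    · rw [Set.not_nontrivial_iff] at hS'
      obtain ⟨w, hw, hwv⟩ := hS.exists_ne v
      have hwS := hw.resolve_left hwv
      have hcut : ∀ E : V → V → Prop, E v w → HasCut E (insert v (S : Set V)) := by
        refine fun E hE => ⟨{v}, ⟨v, Set.mem_insert _ _, rfl⟩, ⟨w, hw, hwv⟩, ?_⟩
        rintro x - rfl y (rfl | hy) hyv
        · exact absurd rfl hyv
        · rwa [hS' hy hwS]
      exact (hGH v w hwv.symm).imp (hcut G) (hcut H)

/-! ### Universality -/

theorem levelLabel_congr {i k : ℤ} (h : Even i ↔ Even k) (m n : ℕ) :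
    levelLabel i m n = levelLabel k m n := by
  unfold levelLabel
  simp only [h]

/-- The colour is written into a coordinate `K` of the parity of `k`, above all supports of the
given embeddings. It decides pairs of different colours and is invisible within a colour class. -/
theorem exists_embedding_of_coloring {V : Type*} [Finite V] {g : V → V → Atom} (c : V → ℕ) (k : ℤ)
    (hc : ∀ x y, c x ≠ c y → g x y = levelLabel k (c x) (c y))
    (h : ∀ m, ∃ s : {x // c x = m} → Point, ∀ x y, label (s x) (s y) = g x y) :
    ∃ s : V → Point, ∀ x y, label (s x) (s y) = g x y := by
  classical
  have := Fintype.ofFinite V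
  choose s hs using h
  set s₀ : V → Point := fun x => s (c x) ⟨x, rfl⟩
  have hs₀' : ∀ x y, c x = c y → label (s₀ x) (s₀ y) = g x y := by
    have : ∀ m x (hx : c x = m), s₀ x = s m ⟨x, hx⟩ := by
      rintro m x rfl
      rfl
    intro x y hxy
    rw [this _ x hxy, this _ y rfl, hs]
  obtain ⟨M, hM⟩ := Finset.exists_le (Finset.univ.biUnion fun x => (s₀ x).support)
  obtain ⟨K, hKM, hK⟩ : ∃ K, M < K ∧ (Even K ↔ Even k) := by
    by_cases h : Even (M + 1) ↔ Even k
    · exact ⟨M + 1, by omega, h⟩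
    · refine ⟨M + 1 + 1, by omega, ?_⟩
      rw [Int.even_add_one]
      tauto
  have hzero : ∀ x j, M < j → s₀ x j = 0 := by
    intro x j hj
    by_contra hne
    refine absurd (hM j ?_) hj.not_ge
    exact Finset.mem_biUnion.2 ⟨x, Finset.mem_univ x, Finsupp.mem_support_iff.2 hne⟩
  refine ⟨fun x => (s₀ x).update K (c x), fun x y => ?_⟩
  by_cases hxy : c x = c y
  · rw [← hs₀' x y hxy]
    simp only [hxy]
    by_cases heq : s₀ x = s₀ y
    · rw [heq, label_self, label_self]
    obtain ⟨i, hi, hi'⟩ := exists_max_ne heq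
    have hiK : i ≠ K := by
      rintro rfl
      exact hi ((hzero x _ hKM).trans (hzero y _ hKM).symm)
    rw [label_eq hi hi', label_eq (i := i)]
    · simp [Function.update_of_ne hiK]
    · simpa [Function.update_of_ne hiK] using hi
    · intro j hj
      by_cases hjK : j = K
      · simp [hjK]
      · simpa [Function.update_of_ne hjK] using hi' j hj
  · rw [hc x y hxy, label_eq (i := K)]
    · simp [levelLabel_congr hK]
    · simpa using hxy
    · intro j hj
      simp [Function.update_of_ne hj.ne', hzero _ j (hKM.trans hj)]

theorem IsPathFree.exists_coloring {V : Type*} [Finite V] {g : V → V → Atom} (h : IsPathFree g)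
    (he : ∀ x y, g x y = e → x = y)
    (hcut : HasCut (fun x y => g x y ≠ a) Set.univ) :
    ∃ c : V → ℕ, (∃ x y, c x ≠ c y) ∧ ∀ x y, c x ≠ c y → g x y = levelLabel 1 (c x) (c y) := by
  obtain ⟨P, ⟨p, -, hp⟩, ⟨q, -, hq⟩, hP⟩ := hcut
  -- The colours are the `a`-connected components, embedded in the tournament on `ℕ`; the cut shows
  -- that there are at least two.
  let ρ : Setoid V := Relation.EqvGen.setoid fun x y => g x y = a
  have hρP : ∀ x y, ρ x y → (x ∈ P ↔ y ∈ P) := by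
    intro x y hxy
    induction hxy with
    | rel x y hxy =>
      by_cases hx : x ∈ P <;> by_cases hy : y ∈ P <;> simp only [hx, hy]
      · exact absurd hxy (hP x trivial hx y trivial hy)
      · refine absurd ?_ (hP y trivial hy x trivial hx)
        rw [h.symm x y, hxy]
        rfl
    | refl x => rfl
    | symm x y _ ih => exact ih.symm
    | trans x y z _ _ ih ih' => exact ih.trans ih'
  have hlab : ∀ x y, ¬ ρ x y → g x y ≠ a ∧ g x y ≠ e := by
    refine fun x y hxy => ⟨fun h => hxy (Relation.EqvGen.rel x y h), fun h => hxy ?_⟩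
    rw [he x y h]
  -- Labels between two components are constant, since an `a`-edge inside one of them cannot reverse
  -- an `r`-edge to an outside vertex.
  have hleft : ∀ x y, ρ x y → ∀ z, ¬ ρ x z → g x z = g y z := by
    intro x y hxy
    induction hxy with
    | rel x y hxy =>
      intro z hz
      have key : ∀ p q : Atom, p ≠ a → p ≠ e → q ≠ a → q ≠ e → Allowed a q p → p = q := by decide
      have hyz : ¬ ρ y z := fun h' => hz (ρ.trans (Relation.EqvGen.rel x y hxy) h')
      exact key _ _ (hlab x z hz).1 (hlab x z hz).2 (hlab y z hyz).1 (hlab y z hyz).2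
        (hxy ▸ h.allowed x z y)
    | refl x => exact fun _ _ => rfl
    | symm x y hxy ih => exact fun z hz => (ih z fun h' => hz (ρ.trans (ρ.symm hxy) h')).symm
    | trans x y z hxy _ ih ih' =>
      exact fun w hw => (ih w hw).trans (ih' w fun h' => hw (ρ.trans hxy h'))
  have hout : ∀ x y, ¬ ρ x y →
      g x y = g (Quotient.mk ρ x).out (Quotient.mk ρ y).out := by
    intro x y hxy
    have hx : ρ x (Quotient.mk ρ x).out := ρ.symm (Quotient.mk_out x)
    have hy : ρ y (Quotient.mk ρ y).out := ρ.symm (Quotient.mk_out y)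
    rw [hleft x _ hx y hxy, h.symm y, hleft y _ hy _ fun h' => hxy (ρ.symm (ρ.trans h' (ρ.symm hx))),
      ← h.symm]
  have hrc : ∀ p : Atom, p ≠ a → p ≠ e → (p.conv = r ↔ ¬ p = r) := by decide
  obtain ⟨t, ht⟩ := exists_tournament_embedding (Q := Quotient ρ) (fun x y => g x.out y.out = r) (by
    intro x y hxy
    have : ¬ ρ x.out y.out := fun h' => hxy (Quotient.out_equiv_out.1 h')
    rw [h.symm x.out y.out]
    exact hrc _ (hlab _ _ this).1 (hlab _ _ this).2)
  refine ⟨fun x => t (Quotient.mk ρ x), ⟨p, q, (ht _ _ ?_).1⟩, fun x y hxy => ?_⟩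
  · exact fun h' => hq ((hρP p q (Quotient.exact h')).1 hp)
  · have hne : Quotient.mk ρ x ≠ Quotient.mk ρ y := by
      intro h'
      exact hxy (congrArg t h')
    have hxy' : ¬ ρ x y := fun h' => hne (Quotient.sound h')
    have hd := (ht _ _ hne).2
    rw [← hout x y hxy'] at hd
    simp only [levelLabel, hd]
    obtain ⟨h1, h2⟩ := hlab x y hxy'
    revert h1 h2
    cases g x y <;> simp

theorem IsPathFree.exists_embedding {V : Type*} [Finite V] {g : V → V → Atom} (h : IsPathFree g) :
    ∃ s : V → Point, ∀ x y, label (s x) (s y) = g x y := by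
  classical
  induction hn : Nat.card V using Nat.strong_induction_on generalizing V with
  | _ n ih =>
  subst hn
  have hsub : ∀ (p : V → Prop) (x : V), ¬ p x →
      ∃ s : {x // p x} → Point, ∀ x y, label (s x) (s y) = g x y := fun p x hx =>
    ih _ (Finite.card_subtype_lt hx) (h.comap Subtype.val) rfl
  by_cases he : ∀ x y, g x y = e → x = y
  swap
  · push Not at he
    obtain ⟨x, y, hxy, hne⟩ := he
    -- Distinct vertices may carry the label `e`. One of them is removed and then sent to the point
    -- of the other.
    obtain ⟨s, hs⟩ := hsub (fun z => z ≠ x) x (fun h => h rfl)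
    refine ⟨fun z => if hz : z = x then s ⟨y, hne.symm⟩ else s ⟨z, hz⟩, fun z w => ?_⟩
    dsimp only
    split_ifs with hz hw hw
    · rw [hs, hz, hw, h.refl, h.refl]
    · rw [hs, hz, h.congr_left hxy]
    · rw [hs, hw, h.congr_right hxy]
    · rw [hs]
  have hcol : ∀ (c : V → ℕ) (k : ℤ), (∃ x y, c x ≠ c y) →
      (∀ x y, c x ≠ c y → g x y = levelLabel k (c x) (c y)) →
      ∃ s : V → Point, ∀ x y, label (s x) (s y) = g x y := by
    rintro c k ⟨x, y, hxy⟩ hc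
    refine exists_embedding_of_coloring c k hc fun m => ?_
    by_cases hx : c x = m
    · exact hsub _ y fun hy => hxy (hx.trans hy.symm)
    · exact hsub _ x hx
  rcases subsingleton_or_nontrivial V with hV | hV
  · refine ⟨fun _ => 0, fun x y => ?_⟩
    rw [Subsingleton.elim x y, h.refl, label_self]
  have hconv : ∀ p : Atom, p.conv = a ↔ p = a := by decide
  have := Fintype.ofFinite V
  have hcut := hasCut_or_hasCut (G := fun x y => g x y = a) (H := fun x y => g x y ≠ a)
    (fun x y hxy => by rw [h.symm x y, hconv]; exact hxy)
    (fun x y hxy => by rw [h.symm x y, Ne, hconv]; exact hxy)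
    (fun x y _ => em _) h.not_path Finset.univ (by simpa using Set.nontrivial_univ)
  rw [Finset.coe_univ] at hcut
  rcases hcut with ⟨P, ⟨p, -, hp⟩, ⟨q, -, hq⟩, hP⟩ | hcut
  -- At an even level only the inequality of the colours matters, so the two sides of the cut
  -- suffice as colour classes.
  · refine hcol (fun x => if x ∈ P then 0 else 1) 0 ⟨p, q, by simp [hp, hq]⟩ fun x y hxy => ?_
    rw [(levelLabel_eq_a_iff 0 _ _).2 Even.zero]
    by_cases hx : x ∈ P <;> by_cases hy : y ∈ P
    · simp [hx, hy] at hxy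
    · exact hP x trivial hx y trivial hy
    · rw [h.symm y x, hP y trivial hy x trivial hx]
      rfl
    · simp [hx, hy] at hxy
  · obtain ⟨c, hc, hc'⟩ := h.exists_coloring he hcut
    exact hcol c 1 hc hc'

theorem PathFree.exists_embedding {V : Type*} {f : Network Carrier V} (h : PathFree V f) :
    ∃ s : V → Point, ∀ x y, f x y = {label (s x) (s y)} := by
  have := h.1
  obtain ⟨g, hg, hfg⟩ := h.exists_atoms
  obtain ⟨s, hs⟩ := hg.exists_embedding
  exact ⟨s, fun x y => by rw [hfg, hs]⟩

theorem pathFree_label {V : Type*} [Finite V] (s : V → Point) :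
    PathFree V fun x y => ({label (s x) (s y)} : Set Atom) :=
  pathFree_of_satisfiableIn universalRepresentation ⟨s, fun _ _ => rfl⟩
    fun _ _ => Set.isAtom_singleton _

/-! ### Amalgamation -/

/-- Both networks are placed in `Point` independently. Images may overlap, because label `e` between
distinct vertices is permitted. -/
theorem pathFree_jep : JEP PathFree.{v} := by
  rintro k m α _ V₁ V₂ f₁ f₂ h₁ h₂ - hcard - -
  have hdisj : ∀ x ∈ V₂, x ∉ V₁ := by
    intro x hx₂ hx₁
    have := Finset.card_eq_zero.1 hcard
    exact Finset.notMem_empty x (this ▸ Finset.mem_inter.2 ⟨hx₁, hx₂⟩)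
  obtain ⟨s₁, hs₁⟩ := h₁.exists_embedding
  obtain ⟨s₂, hs₂⟩ := h₂.exists_embedding
  let s : (V₁ ∪ V₂ : Finset α) → Point := fun x =>
    if hx : x.1 ∈ V₁ then s₁ ⟨x, hx⟩
    else s₂ ⟨x, (Finset.mem_union.1 x.2).resolve_left hx⟩
  refine ⟨_, pathFree_label s, fun x y => ?_, fun x y => ?_⟩
  · simp only [s, x.2, y.2, dif_pos]
    exact (hs₁ x y).symm
  · simp only [s, hdisj x x.2, hdisj y y.2, dif_neg, not_false_eq_true]
    exact (hs₂ x y).symm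

theorem pathFree_ap_three_two (n : ℕ) : AP PathFree.{v} 3 2 n := by
  rintro α _ V₁ V₂ f₁ f₂ h₁ h₂ hc₁ hc - hagree
  obtain ⟨s₁, hs₁⟩ := h₁.exists_embedding
  obtain ⟨s₂, hs₂⟩ := h₂.exists_embedding
  have hw : (V₁ \ V₂).card = 1 := by
    have := Finset.card_sdiff_add_card_inter V₁ V₂
    omega
  obtain ⟨w, hw⟩ := Finset.card_eq_one.1 hw
  obtain ⟨x, y, -, hxy⟩ := Finset.card_eq_two.1 hc
  obtain ⟨hw₁, hw₂⟩ := Finset.mem_sdiff.1 (hw ▸ Finset.mem_singleton_self w)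
  obtain ⟨hx₁, hx₂⟩ := Finset.mem_inter.1 (hxy ▸ Finset.mem_insert_self x {y})
  obtain ⟨hy₁, hy₂⟩ := Finset.mem_inter.1
    (hxy ▸ Finset.mem_insert_of_mem (Finset.mem_singleton_self y))
  have hold : ∀ z (hz₁ : z ∈ V₁) (hz₂ : z ∈ V₂) u (hu₁ : u ∈ V₁) (hu₂ : u ∈ V₂),
      label (s₁ ⟨z, hz₁⟩) (s₁ ⟨u, hu₁⟩) = label (s₂ ⟨z, hz₂⟩) (s₂ ⟨u, hu₂⟩) := by
    intro z hz₁ hz₂ u hu₁ hu₂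
    have := hagree z u hz₁ hz₂ hu₁ hu₂
    rw [hs₁, hs₂] at this
    exact Set.singleton_injective this
  -- The larger network stays fixed in `Point`; the only missing vertex `w` is supplied by a
  -- composition witness over the images of `x` and `y`.
  obtain ⟨b, hb, hb'⟩ := exists_label_eq_of_allowed
    (hold x hx₁ hx₂ y hy₁ hy₂ ▸ label_allowed (s₁ ⟨x, hx₁⟩) (s₁ ⟨y, hy₁⟩) (s₁ ⟨w, hw₁⟩))
  have hnew : ∀ z (hz₁ : z ∈ V₁) (hz₂ : z ∈ V₂),
      label (s₂ ⟨z, hz₂⟩) b = label (s₁ ⟨z, hz₁⟩) (s₁ ⟨w, hw₁⟩) := by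
    intro z hz₁ hz₂
    have hz : z ∈ ({x, y} : Finset α) := hxy ▸ Finset.mem_inter.2 ⟨hz₁, hz₂⟩
    rcases Finset.mem_insert.1 hz with rfl | hz
    · exact hb
    · obtain rfl := Finset.mem_singleton.1 hz
      rw [label_symm, hb', ← label_symm]
  let s : (V₁ ∪ V₂ : Finset α) → Point := fun z => if hz : z.1 ∈ V₂ then s₂ ⟨z, hz⟩ else b
  refine ⟨_, pathFree_label s, ?_, fun z u => ?_⟩
  · rintro ⟨z, hz₁⟩ ⟨u, hu₁⟩
    have hout : ∀ z, z ∈ V₁ → z ∉ V₂ → z = w := fun z h h' =>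
      Finset.mem_singleton.1 (hw ▸ Finset.mem_sdiff.2 ⟨h, h'⟩)
    rw [hs₁]
    congr 1
    by_cases hz₂ : z ∈ V₂ <;> by_cases hu₂ : u ∈ V₂ <;> simp only [s, hz₂, hu₂, dif_pos, dif_neg,
      not_false_eq_true]
    · exact (hold z hz₁ hz₂ u hu₁ hu₂).symm
    · obtain rfl := hout u hu₁ hu₂
      exact hnew z hz₁ hz₂
    · obtain rfl := hout z hz₁ hz₂
      rw [label_symm, hnew u hu₁ hu₂, ← label_symm]
    · obtain rfl := hout z hz₁ hz₂
      obtain rfl := hout u hu₁ hu₂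
      rw [label_self, label_self]
  · simp only [s, z.2, u.2, dif_pos]
    exact (hs₂ z u).symm

/-! ### The path on four vertices -/

/-- The atoms labelling `aPath4`. -/
def aPath4Atom (i j : Fin 4) : Atom :=
  if i = j then e
  else if (i : ℕ) + 1 = j ∨ (j : ℕ) + 1 = i then a
  else if i < j then r
  else rc

theorem aPath4_eq (i j : Fin 4) : aPath4 i j = {aPath4Atom i j} := by
  unfold aPath4 aPath4Atom
  split_ifs <;> rfl

theorem aPath4_atomic : aPath4.Atomic := fun i j => aPath4_eq i j ▸ Set.isAtom_singleton _

theorem aPath4_consistent : aPath4.Consistent := by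
  have h : ∀ i j k, Allowed (aPath4Atom i k) (aPath4Atom k j) (aPath4Atom i j) := by decide
  constructor
  · intro i j k
    rw [aPath4_eq, aPath4_eq, aPath4_eq]
    rintro _ rfl
    exact ⟨_, rfl, _, rfl, h i j k⟩
  · intro i
    simp only [aPath4, if_true]
    exact le_rfl

theorem aPath4_isInducedAPath : IsInducedAPath aPath4 id := by
  refine ⟨Function.injective_id, ?_⟩
  have h : ∀ i j : Fin 4, aPath4Atom i j = a ↔ |(i : ℤ) - (j : ℤ)| = 1 := by decide
  intro i j
  rw [aPath4_eq, Set.singleton_eq_singleton_iff]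
  exact h i j

theorem aPath4_not_satisfiableIn {B : Type*} (R : Representation Carrier B) :
    ¬ aPath4.SatisfiableIn R := fun h =>
  (pathFree_of_satisfiableIn R h aPath4_atomic).2.2.2 ⟨id, aPath4_isInducedAPath⟩

theorem not_fullyUniversal {B : Type u} (R : Representation Carrier B) :
    ¬ Representation.FullyUniversal.{u, v} R := by
  intro h
  obtain ⟨s, hs⟩ := h (ULift.{v} (Fin 4)) (fun i j => aPath4 i.down j.down)
    ⟨fun i j k => aPath4_consistent.1 i.down j.down k.down, fun i => aPath4_consistent.2 i.down⟩
    fun i j => aPath4_atomic i.down j.down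
  exact aPath4_not_satisfiableIn R ⟨fun i => s ⟨i⟩, fun i j => hs ⟨i⟩ ⟨j⟩⟩

theorem satisfiable_tfae {V : Type v} [Finite V] (f : Network Carrier V) :
    List.TFAE
      [Network.Satisfiable.{u} f,
        f.SatisfiableIn universalRepresentation,
        ∃ g : Network Carrier V, PathFree V g ∧ ∀ x y, g x y ≤ f x y] := by
  tfae_have 1 → 3 := fun ⟨_, R, h⟩ => exists_pathFree_le R h
  tfae_have 3 → 2 := by
    rintro ⟨g, hg, hle⟩
    obtain ⟨s, hs⟩ := hg.exists_embedding
    exact ⟨s, fun x y => hle x y (hs x y ▸ rfl)⟩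
  -- `Satisfiable` asks for a domain in universe `u`, whence the lift of `Point`.
  tfae_have 2 → 1 := fun ⟨s, hs⟩ =>
    ⟨ULift.{u} Point, uliftRepresentation universalRepresentation, fun x => ⟨s x⟩, hs⟩
  tfae_finish

end RA1737

theorem mainTheorem3 :
    JEP RA1737.PathFree.{v} ∧
    (∀ n : ℕ, AP RA1737.PathFree.{v} 3 2 n) ∧
    (∃ (B : Type) (R : RelationAlgebra.Representation RA1737.Carrier B), R.Square ∧ R.Faithful ∧
      ∀ (V : Type v) [Finite V] (f : Network RA1737.Carrier V),
        List.TFAE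
          [Network.Satisfiable.{u} f,
            f.SatisfiableIn R,
            ∃ g : Network RA1737.Carrier V, RA1737.PathFree V g ∧ ∀ x y, g x y ≤ f x y]) ∧
    (RA1737.aPath4.Consistent ∧ RA1737.aPath4.Atomic ∧
      RA1737.IsInducedAPath RA1737.aPath4 id ∧ ¬ Network.Satisfiable.{u} RA1737.aPath4) ∧
    (∀ (B : Type u) (R : RelationAlgebra.Representation RA1737.Carrier B),
      ¬ RelationAlgebra.Representation.FullyUniversal.{u, v} R) := by
  exact ⟨RA1737.pathFree_jep, RA1737.pathFree_ap_three_two,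
    ⟨RA1737.Point, RA1737.universalRepresentation, RA1737.universalRepresentation_square,
      RA1737.universalRepresentation_faithful, fun _ _ f => RA1737.satisfiable_tfae f⟩,
    ⟨RA1737.aPath4_consistent, RA1737.aPath4_atomic, RA1737.aPath4_isInducedAPath,
      fun ⟨_, R, h⟩ => RA1737.aPath4_not_satisfiableIn R h⟩,
    fun _ R => RA1737.not_fullyUniversal R⟩
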